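/- Let $n\ge 2$ and consider the plant $\dot x=Ax+B_1w+B_2u$, $z=C_1x$ with $A\in\mathbb R^{n\times n}$, $B_1,B_2\in\mathbb R^{n\times 1}$, $C_1\in\mathbb R^{1\times n}$, such that $C_1B_2\neq 0$ and $R:=C_1B_1+B_1^TC_1^T>0$. Put $Q=I-B_2(C_1B_2)^{-1}C_1$, $A_q=QA$ and, for $\varepsilon>0$, $A_r=A_r(\varepsilon)=Q(A+\varepsilon I)$. A rational transfer function matrix $G$ is strictly negative imaginary (SNI) if it has no poles in $\operatorname{Re}s\ge 0$ and $j(G(j\omega)-G(j\omega)^*)>0$ for all $\omega>0$ for which $j\omega$ is not a pole. Under $u=Kx$ the closed loop is said to be SNI with degree of stability $\varepsilon$ if $C_1(sI-A-B_2K)^{-1}B_1$ is SNI and all eigenvalues of $A+B_2K$ satisfy $\operatorname{Re}s\le-\varepsilon$. Define the reduced controller $K_{\mathrm{red}}(\varepsilon)=-(C_1B_2)^{-1}(C_1A+\varepsilon C_1)$. Further, choose an orthogonal $U$ such that $$U^TA_rU=\begin{bmatrix}\tilde A_{11}&\tilde A_{12}\\0&\tilde A_{22}\end{bmatrix},$$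 where the eigenvalues of $\tilde A_{11}$ lie in $\operatorname{Re}s\le0$ and those of $\tilde A_{22}$ in $\operatorname{Re}s>0$, and let $\tilde B_{22}$, $\tilde C_{22}$ be the corresponding lower blocks of $U^TB_1$ and $U^T(B_2(C_1B_2)^{-1}-B_1R^{-1})$. The Lyapunov conditions hold at $\varepsilon$ if, for such a $U$, there are $T,S\ge0$ with $$-\tilde A_{22}T-T\tilde A_{22}^T+\tilde C_{22}R\tilde C_{22}^T=0,\quad -\tilde A_{22}S-S\tilde A_{22}^T+\tilde B_{22}R^{-1}\tilde B_{22}^T=0,\quad T-S>0 .$$ The associated Lyapunov controller is $K=(C_1B_2)^{-1}\bigl(B_1^TP-C_1A-\varepsilon C_1-R(B_2^TC_1^T)^{-1}B_2^TP\bigr)$ with $P=U\begin{bmatrix}0&0\\0&(T-S)^{-1}\end{bmatrix}U^T$. Assume that $(A,B_2)$ is controllable and that $A_q$ has $n$ distinct eigenvalues $\lambda_1,\dots,\lambda_n$, ordered so that $\operatorname{Re}\lambda_1\le\dots\le\operatorname{Re}\lambda_{n-1}<0$ and $\lambda_n=0$. Let $\gamma=-\operatorname{Re}\lambda_{n-1}$.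 (1) For every $0<\varepsilon<\gamma$, $A_r(\varepsilon)$ has no eigenvalue with positive real part, and the closed loop with $u=K_{\mathrm{red}}(\varepsilon)x$ is SNI with degree of stability $\varepsilon$. (2) Let $n\ge3$ and suppose that the Lyapunov conditions hold at some $\varepsilon_0$ with $-\operatorname{Re}\lambda_{n-1}<\varepsilon_0<-\operatorname{Re}\lambda_{n-2}$. Then the SNI property persists for all $0<\varepsilon<-\operatorname{Re}\lambda_{n-2}$: for $0<\varepsilon\le\gamma$ the closed loop with $K_{\mathrm{red}}(\varepsilon)$ is SNI with degree of stability $\varepsilon$; and for every $\gamma<\varepsilon<-\operatorname{Re}\lambda_{n-2}$ the Lyapunov conditions hold at $\varepsilon$, and the closed loop with every associated Lyapunov controller (for any admissible $U,T,S$) is SNI with degree of stability $\varepsilon$. -/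

import Mathlib

/-! State feedback for linear time-invariant systems: transfer functions, the strictly negative
imaginary property, and the controllers built from the stable / anti-stable Schur splitting. -/

noncomputable section

namespace SNIFeedback

/-- The eigenvalues (over `ℂ`) of a real square matrix. -/
def eigs {ι : Type*} [Fintype ι] [DecidableEq ι] (M : Matrix ι ι ℝ) : Set ℂ :=
  spectrum ℂ (M.map (fun a : ℝ => (a : ℂ)))

/-- The transfer function matrix `C (sI - A)⁻¹ B`, as a matrix of rational functions of `s`. -/
def transfer {n m : ℕ} (A : Matrix (Fin n) (Fin n) ℝ) (B : Matrix (Fin n) (Fin m) ℝ)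
    (C : Matrix (Fin m) (Fin n) ℝ) : Matrix (Fin m) (Fin m) (RatFunc ℂ) :=
  C.map (fun a : ℝ => RatFunc.C (a : ℂ)) *
    ((RatFunc.X : RatFunc ℂ) • (1 : Matrix (Fin n) (Fin n) (RatFunc ℂ)) -
      A.map (fun a : ℝ => RatFunc.C (a : ℂ)))⁻¹ *
    B.map (fun a : ℝ => RatFunc.C (a : ℂ))

/-- `s` is a pole of `G`: in lowest terms, the denominator of some entry vanishes at `s`. -/
def IsPole {m : ℕ} (G : Matrix (Fin m) (Fin m) (RatFunc ℂ)) (s : ℂ) : Prop :=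
  ∃ i j, (G i j).denom.IsRoot s

/-- The value `G(s)` (meaningful where `s` is not a pole). -/
def evalAt {m : ℕ} (G : Matrix (Fin m) (Fin m) (RatFunc ℂ)) (s : ℂ) :
    Matrix (Fin m) (Fin m) ℂ :=
  G.map (fun g => RatFunc.eval (RingHom.id ℂ) s g)

open scoped ComplexOrder in
/-- Strictly negative imaginary transfer function matrix. -/
structure IsSNI {m : ℕ} (G : Matrix (Fin m) (Fin m) (RatFunc ℂ)) : Prop where
  no_pole : ∀ s : ℂ, 0 ≤ s.re → ¬ IsPole G s
  pos : ∀ ω : ℝ, 0 < ω → ¬ IsPole G (Complex.I * ω) →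
    (Complex.I • (evalAt G (Complex.I * ω) -
      (evalAt G (Complex.I * ω)).conjTranspose)).PosDef

/-- The system `ẋ = A x + B w`, `z = C x` is SNI with degree of stability `ε`: its transfer
function is SNI and all eigenvalues of `A` lie in the half plane `Re s ≤ -ε`. -/
def SNIWithDegree {n m : ℕ} (A : Matrix (Fin n) (Fin n) ℝ) (B : Matrix (Fin n) (Fin m) ℝ)
    (C : Matrix (Fin m) (Fin n) ℝ) (ε : ℝ) : Prop :=
  IsSNI (transfer A B C) ∧ ∀ z ∈ eigs A, z.re ≤ -ε

/-- Controllability of the pair `(A, B)`: the matrix `[B, AB, …, Aⁿ⁻¹B]` has rank `n`. -/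
def Controllable {n m : ℕ} (A : Matrix (Fin n) (Fin n) ℝ) (B : Matrix (Fin n) (Fin m) ℝ) :
    Prop :=
  (Matrix.of (fun (i : Fin n) (k : Fin n × Fin m) => (A ^ (k.1 : ℕ) * B) i k.2)).rank = n

/-- The plant `ẋ = A x + B₁ w + B₂ u`, `z = C₁ x`. -/
structure Plant (n m : ℕ) where
  A : Matrix (Fin n) (Fin n) ℝ
  B₁ : Matrix (Fin n) (Fin m) ℝ
  B₂ : Matrix (Fin n) (Fin m) ℝ
  C₁ : Matrix (Fin m) (Fin n) ℝ

/-- An orthogonal change of basis that brings `M` to block upper triangular form, with the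
eigenvalues of the `11` block in the closed left half plane and an anti-stable `22` block
(of sizes `p` and `q`, possibly zero). -/
structure SchurSplit {n : ℕ} (M : Matrix (Fin n) (Fin n) ℝ) (p q : ℕ) where
  U : Matrix (Fin n) (Fin p ⊕ Fin q) ℝ
  mul_transpose : U * U.transpose = 1
  transpose_mul : U.transpose * U = 1
  block₂₁ : (U.transpose * M * U).toBlocks₂₁ = 0
  stable₁₁ : ∀ z ∈ eigs (U.transpose * M * U).toBlocks₁₁, z.re ≤ 0
  antistable₂₂ : ∀ z ∈ eigs (U.transpose * M * U).toBlocks₂₂, 0 < z.re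

/-- The `22` block of the transformed matrix. -/
def SchurSplit.A₂₂ {n p q : ℕ} {M : Matrix (Fin n) (Fin n) ℝ} (d : SchurSplit M p q) :
    Matrix (Fin q) (Fin q) ℝ :=
  (d.U.transpose * M * d.U).toBlocks₂₂

/-- The lower block of `Uᵀ V`. -/
def SchurSplit.lower {n m p q : ℕ} {M : Matrix (Fin n) (Fin n) ℝ} (d : SchurSplit M p q)
    (V : Matrix (Fin n) (Fin m) ℝ) : Matrix (Fin q) (Fin m) ℝ :=
  (d.U.transpose * V).submatrix Sum.inr id

namespace Plant

variable {n m : ℕ}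

/-- The closed loop is SNI with degree of stability `ε` under the state feedback `u = K x`. -/
def ClosedLoopSNI (G : Plant n m) (K : Matrix (Fin m) (Fin n) ℝ) (ε : ℝ) : Prop :=
  SNIWithDegree (G.A + G.B₂ * K) G.B₁ G.C₁ ε

/-- `R = C₁B₁ + B₁ᵀC₁ᵀ`. -/
def R (G : Plant n m) : Matrix (Fin m) (Fin m) ℝ :=
  G.C₁ * G.B₁ + G.B₁.transpose * G.C₁.transpose

/-- `Q = I - B₂(C₁B₂)⁻¹C₁`. -/
def Q (G : Plant n m) : Matrix (Fin n) (Fin n) ℝ :=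
  1 - G.B₂ * (G.C₁ * G.B₂)⁻¹ * G.C₁

/-- `A_q = QA`. -/
def Aq (G : Plant n m) : Matrix (Fin n) (Fin n) ℝ := G.Q * G.A

/-- `A_r = Q(A + εI)`. -/
def Ar (G : Plant n m) (ε : ℝ) : Matrix (Fin n) (Fin n) ℝ :=
  G.Q * (G.A + ε • (1 : Matrix (Fin n) (Fin n) ℝ))

/-- The controller `K = -(C₁B₂)⁻¹(C₁A + εC₁)`. -/
def reducedGain (G : Plant n m) (ε : ℝ) : Matrix (Fin m) (Fin n) ℝ :=
  -((G.C₁ * G.B₂)⁻¹ * (G.C₁ * G.A + ε • G.C₁))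

variable {ε : ℝ} {p q : ℕ}

/-- `T ≥ 0` and `S ≥ 0` solve the two Lyapunov equations of the splitting, and `T - S > 0`. -/
structure IsLyapunovPair (G : Plant n m) (d : SchurSplit (G.Ar ε) p q)
    (T S : Matrix (Fin q) (Fin q) ℝ) : Prop where
  posT : T.PosSemidef
  posS : S.PosSemidef
  eqT : -(d.A₂₂ * T) - T * d.A₂₂.transpose +
    d.lower (G.B₂ * (G.C₁ * G.B₂)⁻¹ - G.B₁ * G.R⁻¹) * G.R *
      (d.lower (G.B₂ * (G.C₁ * G.B₂)⁻¹ - G.B₁ * G.R⁻¹)).transpose = 0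
  eqS : -(d.A₂₂ * S) - S * d.A₂₂.transpose +
    d.lower G.B₁ * G.R⁻¹ * (d.lower G.B₁).transpose = 0
  posSub : (T - S).PosDef

/-- Solvability of the Lyapunov conditions at the parameter `ε`. -/
def LyapunovSolvable (G : Plant n m) (ε : ℝ) : Prop :=
  ∃ (p q : ℕ) (d : SchurSplit (G.Ar ε) p q) (T S : Matrix (Fin q) (Fin q) ℝ),
    G.IsLyapunovPair d T S

/-- `P = U diag(0, (T - S)⁻¹) Uᵀ`. -/
def lyapunovP (G : Plant n m) (d : SchurSplit (G.Ar ε) p q)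
    (T S : Matrix (Fin q) (Fin q) ℝ) : Matrix (Fin n) (Fin n) ℝ :=
  d.U * (Matrix.fromBlocks 0 0 0 (T - S)⁻¹ : Matrix (Fin p ⊕ Fin q) (Fin p ⊕ Fin q) ℝ) *
    d.U.transpose

/-- The controller
`K = (C₁B₂)⁻¹(B₁ᵀP - C₁A - εC₁ - R(B₂ᵀC₁ᵀ)⁻¹B₂ᵀP)`. -/
def lyapunovGain (G : Plant n m) (d : SchurSplit (G.Ar ε) p q)
    (T S : Matrix (Fin q) (Fin q) ℝ) : Matrix (Fin m) (Fin n) ℝ :=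
  (G.C₁ * G.B₂)⁻¹ *
    (G.B₁.transpose * G.lyapunovP d T S - G.C₁ * G.A - ε • G.C₁ -
      G.R * (G.B₂.transpose * G.C₁.transpose)⁻¹ * G.B₂.transpose * G.lyapunovP d T S)

end Plant

end SNIFeedback

end

open Matrix SNIFeedback

/-! Write `c`, `b`, `d` for `out`, `dir`, `dist`. Then `c b = 1`, `Q = 1 - b c`, and `c` is a left
null vector of both `A_q` and `A_r`. On `ker c` the matrix `A_r` acts as `A_q + ε`, so its
eigenvalues are the `λ_i + ε` with `i < n`, together with `0` (`eigs_Ar`).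

Every closed loop in question is `A_r - ε + κ b uᵀ`, with `u = 0` for the reduced controller and `u`
a left eigenvector of `A_r` for the Lyapunov one. The span of `c` and `u` is invariant under it, so
the transfer function has order at most two and the SNI property becomes one scalar inequality
(`isSNI_transfer`). The other closed-loop modes are eigenvectors of `A_q` killed by `c` and `u`
(`closedLoopSNI_of_invariant`).

For `γ < ε < -Re λ_{n-2}` exactly one eigenvalue of `A_r` is unstable, so the anti-stable block is
the number `a = ε - γ` and the last column of `U` is a unit left eigenvector `u`. With `x = u b`, `y
= u d` the Lyapunov equations give `2a(T - S) = x(Rx - 2y)` (`IsLyapunovPair.gap`), so solvability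
is the positivity of the right side. Carrying `u` from `ε₀` to `ε` multiplies that expression by a
positive factor (`exists_unit_left_eigenvector`), hence solvability at one parameter gives it at
all. The SNI inequality then follows by completing a square. -/

/-- Coercion of a real matrix to a complex one. -/
abbrev cplx {ι κ : Type*} (M : Matrix ι κ ℝ) : Matrix ι κ ℂ := M.map (fun a : ℝ => (a : ℂ))

/-! ### Complexification and eigenvectors of real matrices -/

theorem cplx_mul {ι κ τ : Type*} [Fintype κ] (M : Matrix ι κ ℝ) (N : Matrix κ τ ℝ) :
    cplx (M * N) = cplx M * cplx N :=
  Matrix.map_mul (f := Complex.ofRealHom)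

theorem cplx_one {ι : Type*} [DecidableEq ι] : cplx (1 : Matrix ι ι ℝ) = 1 :=
  Matrix.map_one _ Complex.ofReal_zero Complex.ofReal_one

theorem mem_eigs_iff_mulVec {ι : Type*} [Fintype ι] [DecidableEq ι] {M : Matrix ι ι ℝ} {z : ℂ} :
    z ∈ eigs M ↔ ∃ x : ι → ℂ, x ≠ 0 ∧ cplx M *ᵥ x = z • x := by
  rw [eigs, ← Matrix.spectrum_toLin', ← Module.End.hasEigenvalue_iff_mem_spectrum]
  constructor
  · intro h
    obtain ⟨x, hx⟩ := h.exists_hasEigenvector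
    exact ⟨x, hx.2, by simpa using hx.apply_eq_smul⟩
  · rintro ⟨x, hx, h⟩
    exact Module.End.hasEigenvalue_of_hasEigenvector (x := x)
      ⟨Module.End.mem_eigenspace_iff.2 (by simpa using h), hx⟩

theorem mem_eigs_of_vecMul {ι : Type*} [Fintype ι] [DecidableEq ι] {M : Matrix ι ι ℝ} {z : ℂ}
    {w : ι → ℂ} (hw : w ≠ 0) (h : w ᵥ* cplx M = z • w) : z ∈ eigs M := by
  have : z ∈ eigs Mᵀ := mem_eigs_iff_mulVec.2 ⟨w, hw, by
    rw [← h, ← Matrix.mulVec_transpose]; rfl⟩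
  rw [eigs, Matrix.mem_spectrum_iff_isRoot_charpoly] at this ⊢
  rwa [← Matrix.charpoly_transpose]

theorem cplx_vecMul {ι κ : Type*} [Fintype ι] {M : Matrix ι κ ℝ} {u : ι → ℝ} :
    (fun i => (u i : ℂ)) ᵥ* cplx M = fun j => (((u ᵥ* M) j : ℝ) : ℂ) := by
  ext j
  simp [Matrix.vecMul, dotProduct]

/-- A left eigenvector of a matrix with simple spectrum is not orthogonal to the right
eigenvector with the same eigenvalue. -/
theorem left_eigenvector_eq_zero {n : ℕ} {M : Matrix (Fin n) (Fin n) ℝ} {lam : Fin n → ℂ}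
    (hspec : eigs M = Set.range lam) (hinj : Function.Injective lam)
    {w x : Fin n → ℂ} {μ : ℂ} (hw : w ᵥ* cplx M = μ • w)
    (hx0 : x ≠ 0) (hx : cplx M *ᵥ x = μ • x) (hwx : w ⬝ᵥ x = 0) : w = 0 := by
  -- Left and right eigenvectors for different eigenvalues are orthogonal, and `x` serves for `μ`
  -- itself. So `w` annihilates a whole eigenbasis.
  have hex : ∀ i, ∃ y : Fin n → ℂ, y ≠ 0 ∧ cplx M *ᵥ y = lam i • y ∧ w ⬝ᵥ y = 0 := by
    intro i
    by_cases hi : lam i = μ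
    · exact ⟨x, hx0, hi ▸ hx, hwx⟩
    · obtain ⟨y, hy0, hy⟩ := mem_eigs_iff_mulVec.1 (hspec ▸ Set.mem_range_self i : lam i ∈ eigs M)
      refine ⟨y, hy0, hy, ?_⟩
      have h1 : (w ᵥ* cplx M) ⬝ᵥ y = w ⬝ᵥ (cplx M *ᵥ y) := (Matrix.dotProduct_mulVec _ _ _).symm
      rw [hw, hy, smul_dotProduct, dotProduct_smul, smul_eq_mul, smul_eq_mul] at h1
      have h2 : (lam i - μ) * (w ⬝ᵥ y) = 0 := by linear_combination -h1
      exact (mul_eq_zero.1 h2).resolve_left (sub_ne_zero.2 hi)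
  choose y hy0 hy hwy using hex
  have hli : LinearIndependent ℂ y := by
    refine Module.End.eigenvectors_linearIndependent' (Matrix.toLin' (cplx M)) lam hinj y fun i => ?_
    exact ⟨Module.End.mem_eigenspace_iff.2 (by simpa using hy i), hy0 i⟩
  have hdet : (Matrix.of y).det ≠ 0 := by
    have := (Matrix.linearIndependent_rows_iff_isUnit (A := Matrix.of y)).1 hli
    exact ((Matrix.isUnit_iff_isUnit_det _).1 this).ne_zero
  by_contra hne
  refine hdet (Matrix.exists_mulVec_eq_zero_iff.1 ⟨w, hne, ?_⟩)
  ext i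
  simpa [Matrix.mulVec, dotProduct_comm] using hwy i

/-- Real form of the previous lemma, applied to `c` against `A_q` with `μ = 0` and to `u` against
`A_r` with `μ = ε - γ`. -/
theorem left_eigenvector_unique_span {n : ℕ} {M : Matrix (Fin n) (Fin n) ℝ} {lam : Fin n → ℂ}
    (hspec : eigs M = Set.range lam) (hinj : Function.Injective lam)
    {w : Fin n → ℝ} {x : Fin n → ℂ} {μ : ℝ} (hw0 : w ≠ 0) (hw : w ᵥ* M = μ • w)
    (hx0 : x ≠ 0) (hx : cplx M *ᵥ x = (μ : ℂ) • x) : (fun i => (w i : ℂ)) ⬝ᵥ x ≠ 0 := by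
  intro h
  refine hw0 ?_
  have := left_eigenvector_eq_zero hspec hinj (w := fun i => (w i : ℂ)) (μ := (μ : ℂ))
    (by rw [cplx_vecMul, hw]; ext j; simp) hx0 hx h
  ext i
  simpa using congrFun this i

/-! ### Transfer functions of order at most two -/

section Transfer

variable {n : ℕ}

/-- The determinant of `X - A` is the image of a monic polynomial, hence nonzero. Relations between
rows and `A` thereby become relations between entries of the resolvent. -/
theorem transfer_mul_resolvent (A : Matrix (Fin n) (Fin n) ℝ) {m : ℕ}
    {V W : Matrix (Fin m) (Fin n) (RatFunc ℂ)}
    (h : V * ((RatFunc.X : RatFunc ℂ) • (1 : Matrix (Fin n) (Fin n) (RatFunc ℂ)) -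
      A.map (fun a : ℝ => RatFunc.C (a : ℂ))) = W) :
    V = W * ((RatFunc.X : RatFunc ℂ) • (1 : Matrix (Fin n) (Fin n) (RatFunc ℂ)) -
      A.map (fun a : ℝ => RatFunc.C (a : ℂ)))⁻¹ := by
  have hN : ((RatFunc.X : RatFunc ℂ) • (1 : Matrix (Fin n) (Fin n) (RatFunc ℂ)) -
      A.map (fun a : ℝ => RatFunc.C (a : ℂ))) =
      (charmatrix (cplx A)).map (algebraMap (Polynomial ℂ) (RatFunc ℂ)) := by
    ext i j
    by_cases hij : i = j
    · subst hij; simp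
    · simp [hij]
  have hdet : IsUnit ((RatFunc.X : RatFunc ℂ) • (1 : Matrix (Fin n) (Fin n) (RatFunc ℂ)) -
      A.map (fun a : ℝ => RatFunc.C (a : ℂ))).det := by
    rw [hN, isUnit_iff_ne_zero, ← RingHom.mapMatrix_apply, ← RingHom.map_det]
    exact (map_ne_zero_iff _ (RatFunc.algebraMap_injective ℂ)).2
      (Matrix.charpoly_monic (cplx A)).ne_zero
  rw [← h, Matrix.mul_assoc, Matrix.mul_nonsing_inv _ hdet, Matrix.mul_one]

open scoped ComplexOrder in
-- The fraction need not be in lowest terms: the reduced denominator divides `b`, so pole-zero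
-- cancellations do no harm. For a scalar, `i(g - g*) = -2 Im g`.
theorem isSNI_of_fraction {G : Matrix (Fin 1) (Fin 1) (RatFunc ℂ)} {a b : Polynomial ℂ}
    (h : G 0 0 = algebraMap _ (RatFunc ℂ) a / algebraMap _ (RatFunc ℂ) b)
    (hb : ∀ s : ℂ, 0 ≤ s.re → b.eval s ≠ 0)
    (him : ∀ ω : ℝ, 0 < ω → (a.eval (Complex.I * ω) / b.eval (Complex.I * ω)).im < 0) :
    IsSNI G := by
  have hnp : ∀ s : ℂ, 0 ≤ s.re → (G 0 0).denom.eval s ≠ 0 := by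
    intro s hs h0
    obtain ⟨d, hd⟩ := RatFunc.denom_div_dvd a b
    apply hb s hs
    rw [hd, Polynomial.eval_mul, ← h, h0, zero_mul]
  refine ⟨?_, ?_⟩
  · rintro s hs ⟨i, j, hij⟩
    rw [Subsingleton.elim i 0, Subsingleton.elim j 0] at hij
    exact hnp s hs hij
  · intro ω hω _
    set s : ℂ := Complex.I * ω with hs
    have hre : 0 ≤ s.re := by simp [hs]
    have hbs := hb s hre
    have hb0 : b ≠ 0 := by rintro rfl; simp at hbs
    have hev : RatFunc.eval (RingHom.id ℂ) s (G 0 0) = a.eval s / b.eval s := by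
      rw [eq_div_iff hbs]
      have h1 : G 0 0 * algebraMap _ (RatFunc ℂ) b = algebraMap _ (RatFunc ℂ) a := by
        rw [h, div_mul_cancel₀]
        exact (map_ne_zero_iff _ (RatFunc.algebraMap_injective ℂ)).2 hb0
      have h2 := congrArg (RatFunc.eval (RingHom.id ℂ) s) h1
      rw [RatFunc.eval_mul _ _ (by simpa [Polynomial.eval₂_id] using hnp s hre)
        (by simp)] at h2
      simpa [RatFunc.eval_algebraMap] using h2
    have hm : Complex.I • (evalAt G s - (evalAt G s).conjTranspose) =
        Matrix.diagonal fun _ => (((-2 * (a.eval s / b.eval s).im : ℝ)) : ℂ) := by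
      ext i j
      rw [Subsingleton.elim i 0, Subsingleton.elim j 0]
      simp only [evalAt, Matrix.smul_apply, Matrix.sub_apply, Matrix.map_apply,
        Matrix.conjTranspose_apply, hev, Matrix.diagonal_apply_eq, smul_eq_mul]
      generalize a.eval s / b.eval s = g
      apply Complex.ext
      · simp; ring
      · simp
    rw [hm]
    refine Matrix.PosDef.diagonal fun _ => ?_
    rw [Complex.zero_lt_real]
    have := him ω hω
    linarith

/-- A SISO system whose output obeys `y' = -ε y + κ η + p w`, `η' = -(ε + δ) η + r w`. -/
theorem isSNI_transfer {A : Matrix (Fin n) (Fin n) ℝ} {B : Matrix (Fin n) (Fin 1) ℝ}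
    {C W : Matrix (Fin 1) (Fin n) ℝ} {ε δ κ : ℝ} (hε : 0 < ε) (hδ : 0 ≤ δ)
    (hC : C * A = -ε • C + κ • W) (hW : W * A = -(ε + δ) • W) (hp : 0 < (C * B) 0 0)
    (hk : 0 ≤ (C * B) 0 0 * (ε + δ) ^ 2 + κ * (W * B) 0 0 * (2 * ε + δ)) :
    IsSNI (transfer A B C) := by
  set p := (C * B) 0 0
  set r := (W * B) 0 0
  let φ : ℝ →+* RatFunc ℂ := (RatFunc.C).comp Complex.ofRealHom
  let N := (RatFunc.X : RatFunc ℂ) • (1 : Matrix (Fin n) (Fin n) (RatFunc ℂ)) -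
      A.map (fun a : ℝ => RatFunc.C (a : ℂ))
  have hne : ∀ x : ℝ, (RatFunc.X + φ x : RatFunc ℂ) ≠ 0 := by
    intro x
    have : (RatFunc.X + φ x : RatFunc ℂ) =
        algebraMap (Polynomial ℂ) (RatFunc ℂ) (Polynomial.X + Polynomial.C (x : ℂ)) := by
      simp [φ]
    rw [this]
    exact (map_ne_zero_iff _ (RatFunc.algebraMap_injective ℂ)).2 (Polynomial.X_add_C_ne_zero _)
  have hmul : ∀ (V : Matrix (Fin 1) (Fin n) ℝ),
      V.map φ * N = (RatFunc.X : RatFunc ℂ) • V.map φ - (V * A).map φ := by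
    intro V
    rw [Matrix.mul_sub, Matrix.mul_smul, Matrix.mul_one, Matrix.map_mul]
    rfl
  have hWN : W.map φ * N = (RatFunc.X + φ (ε + δ)) • W.map φ := by
    rw [hmul, hW]; ext i j; simp; ring
  have hCN : C.map φ * N = (RatFunc.X + φ ε) • C.map φ - φ κ • W.map φ := by
    rw [hmul, hC]; ext i j; simp; ring
  have hWB : (W.map φ * B.map φ) 0 0 = φ r := by rw [← Matrix.map_mul]; rfl
  have hCB : (C.map φ * B.map φ) 0 0 = φ p := by rw [← Matrix.map_mul]; rfl
  -- Both rows are multiplied by the resolvent and by `B`; eliminating the `W` entry leaves the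
  -- explicit second-order fraction.
  have h1 : φ r = (RatFunc.X + φ (ε + δ)) * (W.map φ * N⁻¹ * B.map φ) 0 0 := by
    have h := congrArg (fun V => (V * B.map φ) 0 0) (transfer_mul_resolvent A hWN)
    simpa only [hWB, Matrix.smul_mul, Matrix.smul_apply, smul_eq_mul] using h
  have h2 : φ p = (RatFunc.X + φ ε) * (transfer A B C) 0 0 -
      φ κ * (W.map φ * N⁻¹ * B.map φ) 0 0 := by
    rw [← hCB, transfer_mul_resolvent A hCN, Matrix.sub_mul, Matrix.smul_mul, Matrix.smul_mul,
      Matrix.sub_mul, Matrix.smul_mul, Matrix.smul_mul, Matrix.sub_apply, Matrix.smul_apply,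
      Matrix.smul_apply, smul_eq_mul, smul_eq_mul]
    rfl
  have hfrac : (transfer A B C) 0 0 =
      algebraMap _ (RatFunc ℂ) (Polynomial.C (p : ℂ) * (Polynomial.X + Polynomial.C ((ε + δ : ℝ) : ℂ))
        + Polynomial.C ((κ * r : ℝ) : ℂ)) /
      algebraMap _ (RatFunc ℂ) ((Polynomial.X + Polynomial.C ((ε : ℝ) : ℂ)) *
        (Polynomial.X + Polynomial.C ((ε + δ : ℝ) : ℂ))) := by
    have e1 : algebraMap (Polynomial ℂ) (RatFunc ℂ) (Polynomial.C (p : ℂ) *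
        (Polynomial.X + Polynomial.C ((ε + δ : ℝ) : ℂ)) + Polynomial.C ((κ * r : ℝ) : ℂ)) =
        φ p * (RatFunc.X + φ (ε + δ)) + φ κ * φ r := by
      rw [← map_mul φ κ r]; simp [φ]
    have e2 : algebraMap (Polynomial ℂ) (RatFunc ℂ) ((Polynomial.X + Polynomial.C ((ε : ℝ) : ℂ)) *
        (Polynomial.X + Polynomial.C ((ε + δ : ℝ) : ℂ))) =
        (RatFunc.X + φ ε) * (RatFunc.X + φ (ε + δ)) := by
      simp [φ]
    rw [e1, e2, eq_div_iff (mul_ne_zero (hne _) (hne _)), h2, h1]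
    ring
  refine isSNI_of_fraction hfrac ?_ ?_
  · intro s hs
    have hx : ∀ x : ℝ, 0 < x → s + x ≠ 0 := by
      intro x hx h
      have := congrArg Complex.re h
      simp at this
      linarith
    simpa using ⟨hx ε hε, by simpa using hx (ε + δ) (by linarith)⟩
  · intro ω hω
    have hd : ∀ x : ℝ, 0 < x → 0 < x ^ 2 + ω ^ 2 := fun x hx => by positivity
    have key : ((Polynomial.eval (Complex.I * ω) (Polynomial.C (p : ℂ) *
        (Polynomial.X + Polynomial.C ((ε + δ : ℝ) : ℂ)) + Polynomial.C ((κ * r : ℝ) : ℂ))) /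
        (Polynomial.eval (Complex.I * ω) ((Polynomial.X + Polynomial.C ((ε : ℝ) : ℂ)) *
        (Polynomial.X + Polynomial.C ((ε + δ : ℝ) : ℂ))))).im =
        -(ω * (p * ω ^ 2 + (p * (ε + δ) ^ 2 + κ * r * (2 * ε + δ)))) /
          ((ε ^ 2 + ω ^ 2) * ((ε + δ) ^ 2 + ω ^ 2)) := by
      have h3 : Complex.normSq (Polynomial.eval (Complex.I * ω)
          ((Polynomial.X + Polynomial.C ((ε : ℝ) : ℂ)) *
          (Polynomial.X + Polynomial.C ((ε + δ : ℝ) : ℂ)))) =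
          (ε ^ 2 + ω ^ 2) * ((ε + δ) ^ 2 + ω ^ 2) := by
        simp [Complex.normSq_apply]; ring
      rw [Complex.div_im, h3, ← sub_div]
      congr 1
      simp
      ring
    rw [key]
    refine div_neg_of_neg_of_pos ?_ (mul_pos (hd _ hε) (hd _ (by linarith)))
    have : 0 < p * ω ^ 2 := by positivity
    have := mul_pos hω (add_pos_of_pos_of_nonneg this hk)
    linarith

end Transfer

/-! ### One-by-one matrices -/

theorem posDef_fin_one_iff {M : Matrix (Fin 1) (Fin 1) ℝ} : M.PosDef ↔ 0 < M 0 0 := by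
  have h : M = Matrix.diagonal fun _ => M 0 0 := by
    ext i j; rw [Subsingleton.elim i 0, Subsingleton.elim j 0]; simp
  rw [h, Matrix.posDef_diagonal_iff]; simp

theorem posSemidef_fin_one_iff {M : Matrix (Fin 1) (Fin 1) ℝ} : M.PosSemidef ↔ 0 ≤ M 0 0 := by
  have h : M = Matrix.diagonal fun _ => M 0 0 := by
    ext i j; rw [Subsingleton.elim i 0, Subsingleton.elim j 0]; simp
  rw [h, Matrix.posSemidef_diagonal_iff]; simp

theorem inv_fin_one_apply (M : Matrix (Fin 1) (Fin 1) ℝ) : M⁻¹ 0 0 = (M 0 0)⁻¹ := by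
  rw [Matrix.inv_def]; simp [Ring.inverse_eq_inv']

/-! ### Rank-one structure of the plant and its closed loops -/

namespace SNIFeedback.Plant

variable {n : ℕ} (G : Plant n 1)

/-- The normalized control direction `B₂ (C₁ B₂)⁻¹`. -/
noncomputable def dir : Fin n → ℝ := fun i => (G.B₂ * (G.C₁ * G.B₂)⁻¹) i 0

/-- The output row `C₁`. -/
def out : Fin n → ℝ := fun j => G.C₁ 0 j

/-- The disturbance column `B₁`. -/
def dist : Fin n → ℝ := fun i => G.B₁ i 0

theorem R_apply : G.R 0 0 = 2 * (G.out ⬝ᵥ G.dist) := by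
  simp [R, out, dist, Matrix.mul_apply, dotProduct, two_mul, mul_comm]

theorem dir_eq : (G.B₂ * (G.C₁ * G.B₂)⁻¹) = Matrix.of fun i (_ : Fin 1) => G.dir i := by
  ext i j; rw [Subsingleton.elim j 0]; rfl

theorem Q_eq : G.Q = 1 - vecMulVec G.dir G.out := by
  rw [Q, dir_eq]
  ext i j
  simp [vecMulVec_apply, Matrix.mul_apply, out]

theorem out_dir (h : IsUnit (G.C₁ * G.B₂)) : G.out ⬝ᵥ G.dir = 1 := by
  have h1 : G.C₁ * (G.B₂ * (G.C₁ * G.B₂)⁻¹) = 1 := by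
    rw [← Matrix.mul_assoc, Matrix.mul_nonsing_inv _ ((Matrix.isUnit_iff_isUnit_det _).1 h)]
  have := congrFun (congrFun h1 0) 0
  simpa [Matrix.mul_apply, dotProduct, out, dir] using this

theorem out_ne_zero (h : IsUnit (G.C₁ * G.B₂)) : G.out ≠ 0 := by
  intro h0
  have := G.out_dir h
  simp [h0] at this

theorem out_vecMul_Q (h : IsUnit (G.C₁ * G.B₂)) : G.out ᵥ* G.Q = 0 := by
  rw [Q_eq, Matrix.vecMul_sub, Matrix.vecMul_one, Matrix.vecMul_vecMulVec, G.out_dir h]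
  simp

theorem out_vecMul_Aq (h : IsUnit (G.C₁ * G.B₂)) : G.out ᵥ* G.Aq = 0 := by
  rw [Aq, ← Matrix.vecMul_vecMul, G.out_vecMul_Q h, Matrix.zero_vecMul]

theorem out_vecMul_Ar (h : IsUnit (G.C₁ * G.B₂)) (ε : ℝ) : G.out ᵥ* G.Ar ε = 0 := by
  rw [Ar, ← Matrix.vecMul_vecMul, G.out_vecMul_Q h, Matrix.zero_vecMul]

theorem Ar_eq (ε : ℝ) : G.Ar ε = G.Aq + ε • (1 - vecMulVec G.dir G.out) := by
  rw [Ar, Aq, Matrix.mul_add, Matrix.mul_smul, Matrix.mul_one, Q_eq]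

theorem vecMul_Ar (u : Fin n → ℝ) (ε : ℝ) :
    u ᵥ* G.Ar ε = u ᵥ* G.Aq + ε • u - (ε * (u ⬝ᵥ G.dir)) • G.out := by
  rw [Ar_eq, Matrix.vecMul_add, Matrix.vecMul_smul, Matrix.vecMul_sub, Matrix.vecMul_one,
    Matrix.vecMul_vecMulVec, smul_sub, smul_smul, add_sub_assoc]

/-- `Q` is the identity on `ker c`, but the shift must act after `A`; since `Q(A + ε) = A_q + εQ`,
the term `εQx` is just `εx`. -/
theorem Ar_mulVec {x : Fin n → ℂ} (hx : (fun i => (G.out i : ℂ)) ⬝ᵥ x = 0) (ε : ℝ) :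
    cplx (G.Ar ε) *ᵥ x = cplx G.Aq *ᵥ x + (ε : ℂ) • x := by
  have h : cplx (G.Ar ε) = cplx G.Aq + (ε : ℂ) •
      (1 - vecMulVec (fun i => (G.dir i : ℂ)) (fun i => (G.out i : ℂ))) := by
    rw [Ar_eq]; ext i j
    by_cases hij : i = j
    · subst hij; simp [vecMulVec_apply]
    · simp [vecMulVec_apply, hij]
  rw [h, Matrix.add_mulVec, Matrix.smul_mulVec, Matrix.sub_mulVec, Matrix.one_mulVec,
    Matrix.vecMulVec_mulVec, hx]
  simp

/-- The closed loop matrix of a feedback that is built around the reduced controller. -/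
theorem closedLoop_eq (ε : ℝ) (L : Matrix (Fin 1) (Fin n) ℝ) :
    G.A + G.B₂ * ((G.C₁ * G.B₂)⁻¹ * (L - G.C₁ * G.A - ε • G.C₁)) =
      G.Ar ε - ε • (1 : Matrix (Fin n) (Fin n) ℝ) + vecMulVec G.dir (L 0) := by
  have h1 : vecMulVec G.dir (L 0) = G.B₂ * (G.C₁ * G.B₂)⁻¹ * L := by
    rw [dir_eq]; ext i j; simp [vecMulVec_apply, Matrix.mul_apply]
  rw [h1, Ar, Q]
  simp only [Matrix.mul_sub, Matrix.mul_add, Matrix.sub_mul, Matrix.mul_smul, Matrix.mul_one,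
    Matrix.one_mul, Matrix.mul_assoc]
  module

theorem closedLoop_reducedGain (ε : ℝ) : G.A + G.B₂ * G.reducedGain ε =
    G.Ar ε - ε • (1 : Matrix (Fin n) (Fin n) ℝ) := by
  have h : G.reducedGain ε = (G.C₁ * G.B₂)⁻¹ * (0 - G.C₁ * G.A - ε • G.C₁) := by
    rw [reducedGain, ← Matrix.mul_neg]; congr 1; module
  rw [h, closedLoop_eq]
  ext i j; simp [vecMulVec_apply]

theorem dotProduct_mulVec_eq {M : Matrix (Fin n) (Fin n) ℝ} {u : Fin n → ℝ} {x : Fin n → ℂ}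
    {z : ℂ} (hx : cplx M *ᵥ x = z • x) :
    (fun i => (((u ᵥ* M) i : ℝ) : ℂ)) ⬝ᵥ x = z * ((fun i => (u i : ℂ)) ⬝ᵥ x) := by
  rw [← cplx_vecMul, ← Matrix.dotProduct_mulVec, hx, dotProduct_smul, smul_eq_mul]

/-- Closed loops in which the span of the output and of a left eigenvector `u` of `A_r` is
invariant. -/
theorem closedLoopSNI_of_invariant (h : IsUnit (G.C₁ * G.B₂)) (hR : 0 < G.R 0 0)
    {K : Matrix (Fin 1) (Fin n) ℝ} {u : Fin n → ℝ} {ε δ κ a : ℝ} (hε : 0 < ε) (hδ : 0 ≤ δ)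
    (hK : G.A + G.B₂ * K = G.Ar ε - ε • (1 : Matrix (Fin n) (Fin n) ℝ) +
      κ • vecMulVec G.dir u)
    (hu : u ᵥ* G.Ar ε = a • u) (ha : a + κ * (u ⬝ᵥ G.dir) = -δ)
    (hk : 0 ≤ G.R 0 0 / 2 * (ε + δ) ^ 2 + κ * (u ⬝ᵥ G.dist) * (2 * ε + δ))
    (heig : ∀ (z : ℂ) (x : Fin n → ℂ), x ≠ 0 → cplx G.Aq *ᵥ x = z • x →
      (fun i => (G.out i : ℂ)) ⬝ᵥ x = 0 → (fun i => (u i : ℂ)) ⬝ᵥ x = 0 → z.re ≤ -ε) :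
    G.ClosedLoopSNI K ε := by
  have hc : G.out ᵥ* (G.A + G.B₂ * K) = -ε • G.out + κ • u := by
    rw [hK, Matrix.vecMul_add, Matrix.vecMul_sub, G.out_vecMul_Ar h, Matrix.vecMul_smul,
      Matrix.vecMul_smul, Matrix.vecMul_one, Matrix.vecMul_vecMulVec, G.out_dir h]
    module
  have hu' : u ᵥ* (G.A + G.B₂ * K) = -(ε + δ) • u := by
    rw [hK, Matrix.vecMul_add, Matrix.vecMul_sub, hu, Matrix.vecMul_smul,
      Matrix.vecMul_smul, Matrix.vecMul_one, Matrix.vecMul_vecMulVec,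
      show -(ε + δ) = a + κ * (u ⬝ᵥ G.dir) - ε by rw [ha]; ring]
    module
  have hp : (G.C₁ * G.B₁) 0 0 = G.R 0 0 / 2 := by
    rw [R_apply]; simp [Matrix.mul_apply, dotProduct, out, dist]
  refine ⟨isSNI_transfer (W := Matrix.of fun _ => u) (κ := κ) (δ := δ) hε hδ ?_ ?_ ?_ ?_, ?_⟩
  · ext i j
    rw [Subsingleton.elim i 0]
    exact congrFun hc j
  · ext i j
    exact congrFun hu' j
  · rw [hp]; linarith
  · rw [hp]
    exact hk
  -- Pairing an eigenvector with `u` and then with `c` forces `z = -(ε + δ)`, or `z = -ε`, or both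
  -- pairings vanish. In the last case the rank-one terms drop out and the shifts by `ε` cancel,
  -- leaving an eigenvector of `A_q`.
  · intro z hz
    obtain ⟨x, hx0, hx⟩ := mem_eigs_iff_mulVec.1 hz
    have hux := dotProduct_mulVec_eq (u := u) hx
    rw [hu'] at hux
    have hux' : (z + (ε + δ)) * ((fun i => (u i : ℂ)) ⬝ᵥ x) = 0 := by
      have : (fun i => ((((-(ε + δ)) • u) i : ℝ) : ℂ)) = (-(ε + δ) : ℂ) • fun i => (u i : ℂ) := by
        ext i; simp
      rw [this, smul_dotProduct, smul_eq_mul] at hux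
      linear_combination -hux
    rcases mul_eq_zero.1 hux' with h1 | h1
    · have := congrArg Complex.re h1
      simp at this; linarith
    have hcx := dotProduct_mulVec_eq (u := G.out) hx
    rw [hc] at hcx
    have hcx' : (z + ε) * ((fun i => (G.out i : ℂ)) ⬝ᵥ x) = 0 := by
      have : (fun i => ((((-ε) • G.out + κ • u) i : ℝ) : ℂ)) =
          (-ε : ℂ) • (fun i => (G.out i : ℂ)) + (κ : ℂ) • fun i => (u i : ℂ) := by
        ext i; simp
      rw [this, add_dotProduct, smul_dotProduct, smul_dotProduct, h1, smul_eq_mul] at hcx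
      simp at hcx
      linear_combination -hcx
    rcases mul_eq_zero.1 hcx' with h2 | h2
    · have := congrArg Complex.re h2
      simp at this; linarith
    refine heig z x hx0 ?_ h2 h1
    have hM : cplx (G.A + G.B₂ * K) = cplx (G.Ar ε) - (ε : ℂ) • 1 +
        (κ : ℂ) • vecMulVec (fun i => (G.dir i : ℂ)) (fun i => (u i : ℂ)) := by
      rw [hK]; ext i j
      by_cases hij : i = j
      · subst hij; simp [vecMulVec_apply]
      · simp [vecMulVec_apply, hij]
    rw [hM, Matrix.add_mulVec, Matrix.sub_mulVec, G.Ar_mulVec h2, Matrix.smul_mulVec,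
      Matrix.smul_mulVec, Matrix.one_mulVec, Matrix.vecMulVec_mulVec, h1] at hx
    simpa using hx

/-- Closed loop with the reduced controller. -/
theorem closedLoopSNI_reducedGain (h : IsUnit (G.C₁ * G.B₂)) (hR : 0 < G.R 0 0) {ε : ℝ}
    (hε : 0 < ε)
    (heig : ∀ (z : ℂ) (x : Fin n → ℂ), x ≠ 0 → cplx G.Aq *ᵥ x = z • x →
      (fun i => (G.out i : ℂ)) ⬝ᵥ x = 0 → z.re ≤ -ε) :
    G.ClosedLoopSNI (G.reducedGain ε) ε := by
  refine G.closedLoopSNI_of_invariant h hR (u := 0) (δ := 0) (κ := 0) (a := 0) hε le_rfl ?_ ?_ ?_ ?_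
    fun z x hx0 hx hc _ => heig z x hx0 hx hc
  · rw [closedLoop_reducedGain]; simp
  · simp
  · simp
  · simp only [add_zero, zero_mul]
    positivity

/-! ### Spectra of `A_q` and `A_r` -/

section Spectrum

variable {G} {lam : Fin n → ℂ}

/-- Eigenvectors of `A_q` in the kernel of the output belong to non-zero eigenvalues. -/
theorem exists_eq_lam (h : IsUnit (G.C₁ * G.B₂)) (hspec : eigs G.Aq = Set.range lam)
    (hinj : Function.Injective lam) (hzero : ∀ i : Fin n, ¬ (i : ℕ) + 1 < n → lam i = 0)
    {z : ℂ} {x : Fin n → ℂ} (hx0 : x ≠ 0)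
    (hx : cplx G.Aq *ᵥ x = z • x) (hc : (fun i => (G.out i : ℂ)) ⬝ᵥ x = 0) :
    ∃ i : Fin n, (i : ℕ) + 1 < n ∧ z = lam i := by
  obtain ⟨i, hi⟩ : z ∈ Set.range lam := hspec ▸ mem_eigs_iff_mulVec.2 ⟨x, hx0, hx⟩
  refine ⟨i, ?_, hi.symm⟩
  by_contra hlt
  rw [← hi, hzero i hlt] at hx
  exact left_eigenvector_unique_span hspec hinj (μ := 0) (G.out_ne_zero h)
    (by rw [G.out_vecMul_Aq h, zero_smul]) hx0 (by simpa using hx) hc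

/-- The eigenvalues of `A_r`. -/
noncomputable def lamR (lam : Fin n → ℂ) (ε : ℝ) : Fin n → ℂ := fun i =>
  if (i : ℕ) + 1 < n then lam i + ε else 0

theorem lamR_of_lt {i : Fin n} (hi : (i : ℕ) + 1 < n) (ε : ℝ) : lamR lam ε i = lam i + ε :=
  if_pos hi

theorem lamR_of_not_lt {i : Fin n} (hi : ¬ (i : ℕ) + 1 < n) (ε : ℝ) : lamR lam ε i = 0 :=
  if_neg hi

theorem eigs_Ar (hn : 1 ≤ n) (h : IsUnit (G.C₁ * G.B₂)) (hspec : eigs G.Aq = Set.range lam)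
    (hinj : Function.Injective lam) (hzero : ∀ i : Fin n, ¬ (i : ℕ) + 1 < n → lam i = 0)
    (hne : ∀ i : Fin n, (i : ℕ) + 1 < n → lam i ≠ 0) (ε : ℝ) :
    eigs (G.Ar ε) = Set.range (lamR lam ε) := by
  apply Set.Subset.antisymm
  · intro z hz
    obtain ⟨x, hx0, hx⟩ := mem_eigs_iff_mulVec.1 hz
    have h1 := dotProduct_mulVec_eq (u := G.out) hx
    rw [G.out_vecMul_Ar h] at h1
    have h2 : z * ((fun i => (G.out i : ℂ)) ⬝ᵥ x) = 0 := by
      rw [← h1]; simp [dotProduct]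
    rcases mul_eq_zero.1 h2 with h3 | h3
    -- The last index carries the eigenvalue `0`, which is not shifted by `ε`.
    · exact ⟨⟨n - 1, by omega⟩, by rw [lamR_of_not_lt (by simp; omega), h3]⟩
    · rw [G.Ar_mulVec h3] at hx
      obtain ⟨i, hi, hzi⟩ := exists_eq_lam h hspec hinj hzero (z := z - ε) hx0
        (by rw [sub_smul, ← hx]; simp) h3
      exact ⟨i, by rw [lamR_of_lt hi, ← hzi]; ring⟩
  · rintro _ ⟨i, rfl⟩
    by_cases hi : (i : ℕ) + 1 < n
    · rw [lamR_of_lt hi]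
      obtain ⟨x, hx0, hx⟩ := mem_eigs_iff_mulVec.1 (hspec ▸ Set.mem_range_self i : lam i ∈ eigs G.Aq)
      have h1 := dotProduct_mulVec_eq (u := G.out) hx
      rw [G.out_vecMul_Aq h] at h1
      have h2 : lam i * ((fun i => (G.out i : ℂ)) ⬝ᵥ x) = 0 := by
        rw [← h1]; simp [dotProduct]
      have h3 := (mul_eq_zero.1 h2).resolve_left (hne i hi)
      exact mem_eigs_iff_mulVec.2 ⟨x, hx0, by rw [G.Ar_mulVec h3, hx, add_smul]⟩
    · rw [lamR_of_not_lt hi]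
      refine mem_eigs_of_vecMul (w := fun i => (G.out i : ℂ)) ?_ ?_
      · intro h0
        exact G.out_ne_zero h (funext fun i => by simpa using congrFun h0 i)
      · rw [cplx_vecMul, G.out_vecMul_Ar h]; ext j; simp

/-- The unshifted eigenvalue `0` could collide with some `λ_i + ε`; excluding this keeps the
spectrum of `A_r` simple. -/
theorem lamR_injective {ε : ℝ} (hinj : Function.Injective lam)
    (hne : ∀ i : Fin n, (i : ℕ) + 1 < n → lam i + ε ≠ 0) : Function.Injective (lamR lam ε) := by
  intro i j hij
  by_cases hi : (i : ℕ) + 1 < n <;> by_cases hj : (j : ℕ) + 1 < n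
  · rw [lamR_of_lt hi, lamR_of_lt hj] at hij
    exact hinj (add_right_cancel hij)
  · rw [lamR_of_lt hi, lamR_of_not_lt hj] at hij
    exact absurd hij (hne i hi)
  · rw [lamR_of_not_lt hi, lamR_of_lt hj] at hij
    exact absurd hij.symm (hne j hj)
  · ext; omega

end Spectrum

end SNIFeedback.Plant

/-! ### Schur splittings with a one-dimensional anti-stable block -/

namespace SNIFeedback.SchurSplit

variable {n p q : ℕ} {M : Matrix (Fin n) (Fin n) ℝ}

theorem add_eq (d : SchurSplit M p q) : p + q = n := by
  have h := Matrix.trace_mul_comm d.U d.U.transpose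
  rw [d.mul_transpose, d.transpose_mul, Matrix.trace_one, Matrix.trace_one] at h
  simp at h
  exact_mod_cast h.symm

/-- `Uᵀ(MU)` and `(MU)Uᵀ` have the same characteristic polynomial up to powers of `X`, which agree
because `p + q = n`. -/
theorem charpoly_eq (d : SchurSplit M p q) :
    M.charpoly = (d.U.transpose * M * d.U).toBlocks₁₁.charpoly * d.A₂₂.charpoly := by
  have h1 := Matrix.charpoly_mul_comm' d.U.transpose (M * d.U)
  rw [Matrix.mul_assoc M, d.mul_transpose, Matrix.mul_one, ← Matrix.mul_assoc] at h1
  have h2 : Fintype.card (Fin p ⊕ Fin q) = Fintype.card (Fin n) := by simp [d.add_eq]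
  rw [h2] at h1
  have h3 := mul_left_cancel₀ (pow_ne_zero _ Polynomial.X_ne_zero) h1
  rw [← h3, ← Matrix.fromBlocks_toBlocks (d.U.transpose * M * d.U), d.block₂₁,
    Matrix.charpoly_fromBlocks_zero₂₁]
  rfl

theorem roots_charpoly_of_eigs {lam : Fin n → ℂ} (hspec : eigs M = Set.range lam)
    (hinj : Function.Injective lam) : (cplx M).charpoly.roots = Finset.univ.val.map lam := by
  symm
  refine Multiset.eq_of_le_of_card_le ?_ ?_
  · rw [Multiset.le_iff_subset ((Multiset.nodup_map_iff_of_injective hinj).2 Finset.univ.nodup)]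
    intro z hz
    obtain ⟨i, -, rfl⟩ := Multiset.mem_map.1 hz
    have hi : lam i ∈ eigs M := hspec ▸ Set.mem_range_self i
    exact (Polynomial.mem_roots (Matrix.charpoly_monic _).ne_zero).2
      (Matrix.mem_spectrum_iff_isRoot_charpoly.1 hi)
  · refine (Polynomial.card_roots' _).trans ?_
    simp [Matrix.charpoly_natDegree_eq_dim]

/-- The eigenvalues of the anti-stable block are the eigenvalues with positive real part. -/
theorem roots_charpoly_A₂₂ (d : SchurSplit M p q) {lam : Fin n → ℂ}
    (hspec : eigs M = Set.range lam) (hinj : Function.Injective lam) {i₀ : Fin n}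
    (hpos : 0 < (lam i₀).re) (hneg : ∀ i, i ≠ i₀ → (lam i).re ≤ 0) :
    (cplx d.A₂₂).charpoly.roots = {lam i₀} := by
  classical
  have hroots := roots_charpoly_of_eigs hspec hinj
  have hfac : (cplx M).charpoly = (cplx (d.U.transpose * M * d.U).toBlocks₁₁).charpoly *
      (cplx d.A₂₂).charpoly := by
    have := congrArg (Polynomial.map Complex.ofRealHom) d.charpoly_eq
    rw [Polynomial.map_mul, ← Matrix.charpoly_map, ← Matrix.charpoly_map,
      ← Matrix.charpoly_map] at this
    exact this
  rw [hfac, Polynomial.roots_mul (mul_ne_zero (Matrix.charpoly_monic _).ne_zero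
    (Matrix.charpoly_monic _).ne_zero)] at hroots
  -- Keeping only roots with positive real part removes all roots of the `11` block and none of the
  -- `22` block.
  have hf := congrArg (Multiset.filter fun z : ℂ => 0 < z.re) hroots
  rw [Multiset.filter_add, Multiset.filter_eq_nil.2, Multiset.filter_eq_self.2, zero_add] at hf
  · rw [hf, Multiset.filter_map]
    have : Multiset.filter ((fun z : ℂ => 0 < z.re) ∘ lam) Finset.univ.val = {i₀} := by
      have h1 : (Finset.univ.filter ((fun z : ℂ => 0 < z.re) ∘ lam)) = {i₀} := by
        ext i
        simp only [Function.comp, Finset.mem_filter, Finset.mem_univ, true_and,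
          Finset.mem_singleton]
        refine ⟨fun hi => ?_, fun hi => hi ▸ hpos⟩
        by_contra hne
        exact absurd (hneg i hne) (not_le.2 hi)
      exact congrArg Finset.val h1
    rw [this]; rfl
  · intro z hz
    refine d.antistable₂₂ z (Matrix.mem_spectrum_iff_isRoot_charpoly.2 ?_)
    exact (Polynomial.mem_roots'.1 hz).2
  · intro z hz
    refine not_lt.2 (d.stable₁₁ z (Matrix.mem_spectrum_iff_isRoot_charpoly.2 ?_))
    exact (Polynomial.mem_roots'.1 hz).2

theorem size_eq_one (d : SchurSplit M p q) {lam : Fin n → ℂ}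
    (hspec : eigs M = Set.range lam) (hinj : Function.Injective lam) {i₀ : Fin n}
    (hpos : 0 < (lam i₀).re) (hneg : ∀ i, i ≠ i₀ → (lam i).re ≤ 0) : q = 1 := by
  have h := congrArg Multiset.card (d.roots_charpoly_A₂₂ hspec hinj hpos hneg)
  rw [← (IsAlgClosed.splits _).natDegree_eq_card_roots, Matrix.charpoly_natDegree_eq_dim] at h
  simpa using h

theorem A₂₂_apply_eq (d : SchurSplit M p 1) {lam : Fin n → ℂ}
    (hspec : eigs M = Set.range lam) (hinj : Function.Injective lam) {i₀ : Fin n}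
    (hpos : 0 < (lam i₀).re) (hneg : ∀ i, i ≠ i₀ → (lam i).re ≤ 0) :
    ((d.A₂₂ 0 0 : ℝ) : ℂ) = lam i₀ := by
  have h := d.roots_charpoly_A₂₂ hspec hinj hpos hneg
  have h1 : (cplx d.A₂₂).charpoly = Polynomial.X - Polynomial.C ((d.A₂₂ 0 0 : ℝ) : ℂ) := by
    rw [Matrix.charpoly, Matrix.det_fin_one]; simp
  rw [h1, Polynomial.roots_X_sub_C] at h
  simpa using h

/-- The last column of `U`. -/
def col (d : SchurSplit M p 1) : Fin n → ℝ := fun i => d.U i (Sum.inr 0)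

theorem col_dotProduct_self (d : SchurSplit M p 1) : d.col ⬝ᵥ d.col = 1 := by
  have := congrFun (congrFun d.transpose_mul (Sum.inr 0)) (Sum.inr 0)
  simpa [Matrix.mul_apply, dotProduct, col] using this

theorem col_ne_zero (d : SchurSplit M p 1) : d.col ≠ 0 := by
  intro h
  have := d.col_dotProduct_self
  simp [h] at this

/-- Because the `21` block vanishes, the last row of `Uᵀ M U` is zero except for its final entry. -/
theorem col_vecMul (d : SchurSplit M p 1) : d.col ᵥ* M = d.A₂₂ 0 0 • d.col := by
  have h : d.U.transpose * M = d.U.transpose * M * d.U * d.U.transpose := by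
    rw [Matrix.mul_assoc _ d.U, d.mul_transpose, Matrix.mul_one]
  rw [← Matrix.fromBlocks_toBlocks (d.U.transpose * M * d.U), d.block₂₁] at h
  ext j
  have := congrFun (congrFun h (Sum.inr 0)) j
  rw [Matrix.mul_apply, Matrix.mul_apply, Fintype.sum_sum_type] at this
  simpa [Matrix.vecMul, dotProduct, col, A₂₂] using this

theorem lower_apply {m : ℕ} (d : SchurSplit M p 1) (V : Matrix (Fin n) (Fin m) ℝ) (j : Fin m) :
    d.lower V 0 j = d.col ⬝ᵥ fun i => V i j := by
  simp [lower, Matrix.mul_apply, dotProduct, col]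

/-- A splitting with a one-dimensional anti-stable block, from a left eigenvector. -/
theorem exists_of_left_eigenvector {u : Fin n → ℝ} {a : ℝ} (hn : 1 ≤ n) (hu1 : u ⬝ᵥ u = 1)
    (hu : u ᵥ* M = a • u) (ha : 0 < a)
    (hx : ∀ x : Fin n → ℂ, x ≠ 0 → cplx M *ᵥ x = (a : ℂ) • x →
      (fun i => (u i : ℂ)) ⬝ᵥ x ≠ 0)
    (heig : ∀ z ∈ eigs M, 0 < z.re → z = a) :
    ∃ d : SchurSplit M (n - 1) 1, d.col = u := by
  -- `u` is placed last in an orthonormal basis. As `u` is a left eigenvector, the last row of `Uᵀ M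
  -- U` is `(0, a)`.
  obtain ⟨b, hb⟩ := Orthonormal.exists_orthonormalBasis_extension_of_card_eq
    (𝕜 := ℝ) (E := EuclideanSpace ℝ (Fin n)) (ι := Fin (n - 1) ⊕ Fin 1) (by simp; omega)
    (v := fun _ => WithLp.toLp 2 u) (s := {Sum.inr 0}) (by
      rw [orthonormal_iff_ite]
      intro i j
      rw [Subsingleton.elim i j]
      rw [if_pos rfl]
      simpa only [Set.domRestrict_apply, PiLp.inner_apply, dotProduct, RCLike.inner_apply,
        conj_trivial] using hu1)
  let U : Matrix (Fin n) (Fin (n - 1) ⊕ Fin 1) ℝ := Matrix.of fun i k => b k i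
  have hcol : ∀ i, U i (Sum.inr 0) = u i := fun i => by
    simp [U, hb (Sum.inr 0) rfl]
  have hUtU : U.transpose * U = 1 := by
    ext k l
    have := orthonormal_iff_ite.1 b.orthonormal l k
    simpa [Matrix.mul_apply, U, PiLp.inner_apply, Matrix.one_apply, eq_comm] using this
  have hUUt : U * U.transpose = 1 := by
    have e : Fin n ≃ Fin (n - 1) ⊕ Fin 1 := Fintype.equivOfCardEq (by simp; omega)
    exact (Matrix.mul_eq_one_comm_of_equiv e.symm).1 hUtU
  have hrow : ∀ k, (U.transpose * M * U) (Sum.inr 0) k = if k = Sum.inr 0 then a else 0 := by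
    intro k
    have h1 : (U.transpose * M * U) (Sum.inr 0) k = ((u ᵥ* M) ᵥ* U) k := by
      have : u = U.transpose (Sum.inr 0) := (funext hcol).symm
      rw [this]; rfl
    have h2 : (u ᵥ* U) k = if k = Sum.inr 0 then 1 else 0 := by
      have := congrFun (congrFun hUtU (Sum.inr 0)) k
      rw [Matrix.one_apply] at this
      simp only [eq_comm (a := k)]
      rw [← this]
      simp [Matrix.mul_apply, Matrix.vecMul, dotProduct, hcol]
    rw [h1, hu, Matrix.smul_vecMul, Pi.smul_apply, h2]; simp
  have h21 : (U.transpose * M * U).toBlocks₂₁ = 0 := by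
    ext i j
    rw [Subsingleton.elim i 0]
    simp [Matrix.toBlocks₂₁, hrow]
  have h22 : (U.transpose * M * U).toBlocks₂₂ = Matrix.of fun _ _ => a := by
    ext i j
    rw [Subsingleton.elim i 0, Subsingleton.elim j 0]
    simp [Matrix.toBlocks₂₂, hrow]
  refine ⟨⟨U, hUUt, hUtU, h21, ?_, ?_⟩, funext hcol⟩
  · intro z hz
    obtain ⟨y, hy0, hy⟩ := mem_eigs_iff_mulVec.1 hz
    -- Padding by zero turns an eigenvector of the `11` block into an eigenvector of `M` orthogonal
    -- to `u`. An unstable one would belong to `a`, contradicting `hx`.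
    let y' : Fin (n - 1) ⊕ Fin 1 → ℂ := Sum.elim y 0
    have hy' : cplx (U.transpose * M * U) *ᵥ y' = z • y' := by
      have : cplx (U.transpose * M * U) = Matrix.fromBlocks
          (cplx (U.transpose * M * U).toBlocks₁₁) (cplx (U.transpose * M * U).toBlocks₁₂) 0
          (cplx (U.transpose * M * U).toBlocks₂₂) := by
        conv_lhs => rw [← Matrix.fromBlocks_toBlocks (U.transpose * M * U), h21]
        rw [cplx, Matrix.fromBlocks_map]; congr 1
      rw [this, Matrix.fromBlocks_mulVec]
      ext k
      rcases k with k | k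
      · simpa [y'] using congrFun hy k
      · simp [y']
    have hUc : cplx U * cplx U.transpose = 1 := by rw [← cplx_mul, hUUt, cplx_one]
    have hUc' : cplx U.transpose * cplx U = 1 := by rw [← cplx_mul, hUtU, cplx_one]
    have hprod : cplx (U.transpose * M * U) = cplx U.transpose * cplx M * cplx U := by
      rw [cplx_mul, cplx_mul]
    set x := cplx U *ᵥ y' with hxdef
    have hxM : cplx M *ᵥ x = z • x := by
      have h3 := congrArg (fun w => cplx U *ᵥ w) hy'
      simp only [hprod, Matrix.mulVec_mulVec, Matrix.mulVec_smul] at h3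
      rw [← Matrix.mul_assoc, ← Matrix.mul_assoc, hUc, Matrix.one_mul] at h3
      rw [hxdef, Matrix.mulVec_mulVec, h3]
    have hUx : cplx U.transpose *ᵥ x = y' := by
      rw [hxdef, Matrix.mulVec_mulVec, hUc', Matrix.one_mulVec]
    have hx0 : x ≠ 0 := by
      intro h0
      rw [h0, Matrix.mulVec_zero] at hUx
      exact hy0 (funext fun k => (congrFun hUx (Sum.inl k)).symm)
    have hux : (fun i => (u i : ℂ)) ⬝ᵥ x = 0 := by
      have := congrFun hUx (Sum.inr 0)
      simpa [Matrix.mulVec, dotProduct, hcol, y'] using this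
    by_contra hre
    have hza := heig z (mem_eigs_iff_mulVec.2 ⟨x, hx0, hxM⟩) (not_le.1 hre)
    exact hx x hx0 (hza ▸ hxM) hux
  · intro z hz
    rw [h22] at hz
    obtain ⟨y, hy0, hy⟩ := mem_eigs_iff_mulVec.1 hz
    have h0 : y 0 ≠ 0 := fun h => hy0 (funext fun k => by rw [Subsingleton.elim k 0, h]; rfl)
    have := congrFun hy 0
    simp [Matrix.mulVec, dotProduct] at this
    rcases this with h | h
    · rw [← h]; simpa using ha
    · exact absurd h h0

end SNIFeedback.SchurSplit

/-! ### Scalar Lyapunov equations and the Lyapunov controller -/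

namespace SNIFeedback.Plant

variable {n : ℕ} (G : Plant n 1)

theorem lower_residual {ε : ℝ} {p : ℕ} (d : SchurSplit (G.Ar ε) p 1) :
    d.lower (G.B₂ * (G.C₁ * G.B₂)⁻¹ - G.B₁ * G.R⁻¹) 0 0 =
      d.col ⬝ᵥ G.dir - d.col ⬝ᵥ G.dist / G.R 0 0 := by
  have h : (fun i => (G.B₂ * (G.C₁ * G.B₂)⁻¹ - G.B₁ * G.R⁻¹) i 0) =
      G.dir - (G.R 0 0)⁻¹ • G.dist := by
    ext i
    rw [Matrix.sub_apply, Matrix.mul_apply (M := G.B₁)]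
    simp only [Finset.univ_unique, Fin.default_eq_zero, Finset.sum_singleton, inv_fin_one_apply,
      Pi.sub_apply, Pi.smul_apply, smul_eq_mul, dir, dist]
    ring
  rw [d.lower_apply, h, dotProduct_sub, dotProduct_smul, smul_eq_mul]
  ring

theorem isLyapunovPair_iff {ε : ℝ} {p : ℕ} (d : SchurSplit (G.Ar ε) p 1)
    (T S : Matrix (Fin 1) (Fin 1) ℝ) : G.IsLyapunovPair d T S ↔
      0 ≤ T 0 0 ∧ 0 ≤ S 0 0 ∧
      G.R 0 0 * (d.col ⬝ᵥ G.dir - d.col ⬝ᵥ G.dist / G.R 0 0) ^ 2 = 2 * d.A₂₂ 0 0 * T 0 0 ∧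
      (d.col ⬝ᵥ G.dist) ^ 2 / G.R 0 0 = 2 * d.A₂₂ 0 0 * S 0 0 ∧ 0 < T 0 0 - S 0 0 := by
  have h1 : -(d.A₂₂ * T) - T * d.A₂₂.transpose +
      d.lower (G.B₂ * (G.C₁ * G.B₂)⁻¹ - G.B₁ * G.R⁻¹) * G.R *
        (d.lower (G.B₂ * (G.C₁ * G.B₂)⁻¹ - G.B₁ * G.R⁻¹)).transpose = 0 ↔
      G.R 0 0 * (d.col ⬝ᵥ G.dir - d.col ⬝ᵥ G.dist / G.R 0 0) ^ 2 = 2 * d.A₂₂ 0 0 * T 0 0 := by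
    rw [← lower_residual]
    generalize d.lower (G.B₂ * (G.C₁ * G.B₂)⁻¹ - G.B₁ * G.R⁻¹) = V
    rw [← Matrix.ext_iff]
    simp only [Fin.forall_fin_one, Matrix.add_apply, Matrix.sub_apply, Matrix.neg_apply,
      Matrix.mul_apply, Matrix.transpose_apply, Finset.univ_unique, Fin.default_eq_zero,
      Finset.sum_singleton, Matrix.zero_apply]
    constructor <;> intro h <;> linear_combination h
  have h2 : -(d.A₂₂ * S) - S * d.A₂₂.transpose +
      d.lower G.B₁ * G.R⁻¹ * (d.lower G.B₁).transpose = 0 ↔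
      (d.col ⬝ᵥ G.dist) ^ 2 / G.R 0 0 = 2 * d.A₂₂ 0 0 * S 0 0 := by
    have h3 : d.col ⬝ᵥ G.dist = d.lower G.B₁ 0 0 := (d.lower_apply _ _).symm
    rw [h3, ← Matrix.ext_iff]
    simp only [Fin.forall_fin_one, Matrix.add_apply, Matrix.sub_apply, Matrix.neg_apply,
      Matrix.mul_apply, Matrix.transpose_apply, Finset.univ_unique, Fin.default_eq_zero,
      Finset.sum_singleton, Matrix.zero_apply, inv_fin_one_apply, div_eq_mul_inv]
    constructor <;> intro h <;> linear_combination h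
  constructor
  · rintro ⟨hT, hS, e1, e2, hTS⟩
    exact ⟨posSemidef_fin_one_iff.1 hT, posSemidef_fin_one_iff.1 hS, h1.1 e1, h2.1 e2,
      posDef_fin_one_iff.1 hTS⟩
  · rintro ⟨hT, hS, e1, e2, hTS⟩
    exact ⟨posSemidef_fin_one_iff.2 hT, posSemidef_fin_one_iff.2 hS, h1.2 e1, h2.2 e2,
      posDef_fin_one_iff.2 hTS⟩

variable {G}

/-- The gap `T - S` in closed form. -/
theorem IsLyapunovPair.gap {ε : ℝ} {p : ℕ} {d : SchurSplit (G.Ar ε) p 1}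
    {T S : Matrix (Fin 1) (Fin 1) ℝ} (hR : 0 < G.R 0 0) (h : G.IsLyapunovPair d T S) :
    2 * d.A₂₂ 0 0 * (T 0 0 - S 0 0) = (d.col ⬝ᵥ G.dir) *
      (G.R 0 0 * (d.col ⬝ᵥ G.dir) - 2 * (d.col ⬝ᵥ G.dist)) := by
  obtain ⟨-, -, e1, e2, -⟩ := (G.isLyapunovPair_iff d T S).1 h
  rw [mul_sub, ← e1, ← e2]
  field_simp
  ring

theorem lyapunovSolvable_of_schurSplit {ε : ℝ} {p : ℕ} (d : SchurSplit (G.Ar ε) p 1)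
    (hR : 0 < G.R 0 0) (ha : 0 < d.A₂₂ 0 0)
    (h : 0 < (d.col ⬝ᵥ G.dir) * (G.R 0 0 * (d.col ⬝ᵥ G.dir) - 2 * (d.col ⬝ᵥ G.dist))) :
    G.LyapunovSolvable ε := by
  set a := d.A₂₂ 0 0
  set r := G.R 0 0
  set x := d.col ⬝ᵥ G.dir
  set y := d.col ⬝ᵥ G.dist
  -- The two scalar equations determine `T` and `S`; only the sign of their difference is at stake.
  refine ⟨p, 1, d, Matrix.of fun _ _ => r * (x - y / r) ^ 2 / (2 * a),
    Matrix.of fun _ _ => y ^ 2 / r / (2 * a), (G.isLyapunovPair_iff d _ _).2 ?_⟩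
  simp only [Matrix.of_apply]
  refine ⟨by positivity, by positivity, ?_, ?_, ?_⟩
  · change r * (x - y / r) ^ 2 = 2 * a * _
    field_simp
  · change y ^ 2 / r = 2 * a * _
    field_simp
  · have : r * (x - y / r) ^ 2 / (2 * a) - y ^ 2 / r / (2 * a) =
        x * (r * x - 2 * y) / (2 * a) := by
      field_simp
      ring
    rw [this]
    positivity

theorem lyapunovP_apply {ε : ℝ} {p : ℕ} (d : SchurSplit (G.Ar ε) p 1)
    (T S : Matrix (Fin 1) (Fin 1) ℝ) :
    G.lyapunovP d T S = (T 0 0 - S 0 0)⁻¹ • vecMulVec d.col d.col := by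
  ext i j
  simp [lyapunovP, Matrix.mul_apply, Fintype.sum_sum_type, vecMulVec_apply,
    SchurSplit.col, inv_fin_one_apply, -Matrix.inv_subsingleton]
  ring

/-- Since `P` is a multiple of `u uᵀ`, the feedback adds a single rank-one term, with `κ = (y -
Rx)/(T - S)`. -/
theorem closedLoop_lyapunovGain {ε : ℝ} {p : ℕ} (d : SchurSplit (G.Ar ε) p 1)
    (T S : Matrix (Fin 1) (Fin 1) ℝ) :
    G.A + G.B₂ * G.lyapunovGain d T S = G.Ar ε - ε • (1 : Matrix (Fin n) (Fin n) ℝ) +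
      ((T 0 0 - S 0 0)⁻¹ * (d.col ⬝ᵥ G.dist - G.R 0 0 * (d.col ⬝ᵥ G.dir))) •
        vecMulVec G.dir d.col := by
  set ρ := (T 0 0 - S 0 0)⁻¹ with hρ
  have h : G.lyapunovGain d T S = (G.C₁ * G.B₂)⁻¹ * ((G.B₁.transpose * G.lyapunovP d T S -
      G.R * (G.B₂.transpose * G.C₁.transpose)⁻¹ * G.B₂.transpose * G.lyapunovP d T S) -
      G.C₁ * G.A - ε • G.C₁) := by
    rw [lyapunovGain]; congr 1; abel
  have hX : (G.B₂.transpose * G.C₁.transpose)⁻¹ * G.B₂.transpose =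
      (Matrix.of fun i (_ : Fin 1) => G.dir i).transpose := by
    rw [← dir_eq, Matrix.transpose_mul, Matrix.transpose_nonsing_inv, Matrix.transpose_mul]
  have hL : (G.B₁.transpose * G.lyapunovP d T S -
      G.R * (G.B₂.transpose * G.C₁.transpose)⁻¹ * G.B₂.transpose * G.lyapunovP d T S) 0 =
      (ρ * (d.col ⬝ᵥ G.dist - G.R 0 0 * (d.col ⬝ᵥ G.dir))) • d.col := by
    rw [Matrix.mul_assoc G.R, hX, Matrix.mul_assoc G.R, lyapunovP_apply, ← hρ]
    have h1 : ∀ w : Fin n → ℝ, ((Matrix.of fun i (_ : Fin 1) => w i).transpose *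
        (ρ • vecMulVec d.col d.col)) 0 = (ρ * (d.col ⬝ᵥ w)) • d.col := by
      intro w
      ext j
      simp only [Matrix.mul_apply, Matrix.transpose_apply, Matrix.of_apply, Matrix.smul_apply,
        vecMulVec_apply, Pi.smul_apply, smul_eq_mul, dotProduct]
      rw [Finset.mul_sum, Finset.sum_mul]
      exact Finset.sum_congr rfl fun i _ => by ring
    have h2 : G.B₁ = Matrix.of fun i (_ : Fin 1) => G.dist i := by
      ext i j; rw [Subsingleton.elim j 0]; rfl
    ext j
    have e1 := congrFun (h1 G.dist) j
    have e2 := congrFun (h1 G.dir) j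
    rw [← h2] at e1
    rw [Matrix.sub_apply, e1, Matrix.mul_apply]
    simp only [Finset.univ_unique, Fin.default_eq_zero, Finset.sum_singleton, e2]
    simp only [Pi.smul_apply, smul_eq_mul]
    ring
  rw [h, closedLoop_eq, hL, Matrix.vecMulVec_smul]

/-- Closed loop with a Lyapunov controller when the anti-stable block is one-dimensional. -/
theorem closedLoopSNI_lyapunovGain (h : IsUnit (G.C₁ * G.B₂)) (hR : 0 < G.R 0 0) {ε : ℝ} {p : ℕ}
    (hε : 0 < ε) {d : SchurSplit (G.Ar ε) p 1} {T S : Matrix (Fin 1) (Fin 1) ℝ}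
    (hTS : G.IsLyapunovPair d T S) (ha : 0 < d.A₂₂ 0 0)
    (heig : ∀ (z : ℂ) (x : Fin n → ℂ), x ≠ 0 → cplx G.Aq *ᵥ x = z • x →
      (fun i => (G.out i : ℂ)) ⬝ᵥ x = 0 → (fun i => (d.col i : ℂ)) ⬝ᵥ x = 0 → z.re ≤ -ε) :
    G.ClosedLoopSNI (G.lyapunovGain d T S) ε := by
  have hgap := hTS.gap hR
  have hpos := ((G.isLyapunovPair_iff d T S).1 hTS).2.2.2.2
  have hK := closedLoop_lyapunovGain d T S
  have hu := d.col_vecMul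
  set a := d.A₂₂ 0 0
  set r := G.R 0 0
  set x := d.col ⬝ᵥ G.dir
  set y := d.col ⬝ᵥ G.dist with hy
  set t := T 0 0 - S 0 0
  have hx : x ≠ 0 := by
    intro h0
    rw [h0] at hgap
    have : 0 < 2 * a * t := by positivity
    linarith
  -- By the gap formula, `a + κx = -Rx²/(2t)`: the unstable mode `a` is moved to `-δ`.
  have hδ : 0 < r * x ^ 2 / (2 * t) := by positivity
  refine G.closedLoopSNI_of_invariant h hR (δ := r * x ^ 2 / (2 * t)) (a := a) hε hδ.le hK hu
    ?_ ?_ heig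
  · change a + t⁻¹ * (y - r * x) * x = _
    field_simp
    linear_combination hgap
  · rw [← hy]
    change 0 ≤ r / 2 * (ε + r * x ^ 2 / (2 * t)) ^ 2 + _ * (2 * ε + r * x ^ 2 / (2 * t))
    -- Substituting `δ = Rx²/(2t)` completes the square, so the SNI inequality holds whatever the
    -- sign of `κy`.
    have e : r / 2 * (ε + r * x ^ 2 / (2 * t)) ^ 2 +
        t⁻¹ * (y - r * x) * y * (2 * ε + r * x ^ 2 / (2 * t)) =
        r / 2 * ε ^ 2 + t⁻¹ * (2 * ε + r * x ^ 2 / (2 * t)) * (r * x / 2 - y) ^ 2 := by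
      field_simp
      ring
    rw [e]
    positivity

end SNIFeedback.Plant

/-! ### Transport of the left eigenvector between parameters -/

namespace SNIFeedback.Plant

variable {n : ℕ} {G : Plant n 1}

/-- Left eigenvectors of `A_r` for the eigenvalues `ε - γ` at different parameters. -/
theorem vecMul_Ar_transport (h : IsUnit (G.C₁ * G.B₂)) {u : Fin n → ℝ} {ε₀ ε γ : ℝ}
    (hu : u ᵥ* G.Ar ε₀ = (ε₀ - γ) • u) :
    ((ε - γ) • u + ((ε₀ - ε) * (u ⬝ᵥ G.dir)) • G.out) ᵥ* G.Ar ε =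
      (ε - γ) • ((ε - γ) • u + ((ε₀ - ε) * (u ⬝ᵥ G.dir)) • G.out) := by
  rw [vecMul_Ar] at hu
  have hq : u ᵥ* G.Aq = (-γ) • u + (ε₀ * (u ⬝ᵥ G.dir)) • G.out := by
    have : u ᵥ* G.Aq = (ε₀ - γ) • u - ε₀ • u + (ε₀ * (u ⬝ᵥ G.dir)) • G.out := by
      rw [← hu]; abel
    rw [this]; module
  rw [Matrix.add_vecMul, Matrix.smul_vecMul, Matrix.smul_vecMul, G.out_vecMul_Ar h, vecMul_Ar, hq]
  module

theorem exists_unit_left_eigenvector (h : IsUnit (G.C₁ * G.B₂)) {u : Fin n → ℝ} {ε₀ ε γ : ℝ}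
    (hu : u ᵥ* G.Ar ε₀ = (ε₀ - γ) • u) (hε₀ : γ < ε₀) (hε : γ < ε)
    (hpos : 0 < (u ⬝ᵥ G.dir) * (G.R 0 0 * (u ⬝ᵥ G.dir) - 2 * (u ⬝ᵥ G.dist))) :
    ∃ w : Fin n → ℝ, w ⬝ᵥ w = 1 ∧ w ᵥ* G.Ar ε = (ε - γ) • w ∧
      0 < (w ⬝ᵥ G.dir) * (G.R 0 0 * (w ⬝ᵥ G.dir) - 2 * (w ⬝ᵥ G.dist)) := by
  set w := (ε - γ) • u + ((ε₀ - ε) * (u ⬝ᵥ G.dir)) • G.out with hw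
  have hwA := vecMul_Ar_transport (ε := ε) h hu
  rw [← hw] at hwA
  have hx : w ⬝ᵥ G.dir = (ε₀ - γ) * (u ⬝ᵥ G.dir) := by
    rw [hw, add_dotProduct, smul_dotProduct, smul_dotProduct, G.out_dir h, smul_eq_mul,
      smul_eq_mul]
    ring
  have hy : w ⬝ᵥ G.dist = (ε - γ) * (u ⬝ᵥ G.dist) +
      (ε₀ - ε) * (u ⬝ᵥ G.dir) * (G.R 0 0 / 2) := by
    rw [hw, add_dotProduct, smul_dotProduct, smul_dotProduct, G.R_apply, smul_eq_mul, smul_eq_mul]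
    ring
  have hw_pos : 0 < (w ⬝ᵥ G.dir) * (G.R 0 0 * (w ⬝ᵥ G.dir) - 2 * (w ⬝ᵥ G.dist)) := by
    -- `w b` is `(ε₀ - γ)x`; in `R(w b) - 2(w d)` the `c` contribution changes the coefficient of
    -- `Rx` to `ε - γ`, as `c d = R/2`.
    have : (w ⬝ᵥ G.dir) * (G.R 0 0 * (w ⬝ᵥ G.dir) - 2 * (w ⬝ᵥ G.dist)) = (ε₀ - γ) * (ε - γ) *
        ((u ⬝ᵥ G.dir) * (G.R 0 0 * (u ⬝ᵥ G.dir) - 2 * (u ⬝ᵥ G.dist))) := by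
      rw [hx, hy]; ring
    rw [this]
    exact mul_pos (mul_pos (by linarith) (by linarith)) hpos
  have hww : 0 < w ⬝ᵥ w := by
    refine lt_of_le_of_ne (Finset.sum_nonneg fun i _ => mul_self_nonneg _) fun h0 => ?_
    have : w = 0 := dotProduct_self_eq_zero.1 h0.symm
    rw [this] at hw_pos
    simp at hw_pos
  -- A column of an orthogonal `U` has length one; scaling by `k` multiplies the quadratic
  -- expression by `k² > 0`.
  set k := (Real.sqrt (w ⬝ᵥ w))⁻¹
  have hk : 0 < k := inv_pos.2 (Real.sqrt_pos.2 hww)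
  refine ⟨k • w, ?_, ?_, ?_⟩
  · rw [smul_dotProduct, dotProduct_smul, smul_eq_mul, smul_eq_mul, ← mul_assoc, ← mul_inv,
      Real.mul_self_sqrt hww.le, inv_mul_cancel₀ hww.ne']
  · rw [Matrix.smul_vecMul, hwA, smul_comm]
  · have := mul_pos (mul_pos hk hk) hw_pos
    rw [smul_dotProduct, smul_dotProduct, smul_eq_mul, smul_eq_mul]
    linarith

end SNIFeedback.Plant

/-! ### The main theorem -/

theorem theorem4 {n : ℕ} (hn : 2 ≤ n) (G : SNIFeedback.Plant n 1)
    (hA1 : IsUnit (G.C₁ * G.B₂))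
    (hA2 : G.R.PosDef)
    (hctrl : SNIFeedback.Controllable G.A G.B₂)
    -- the eigenvalues of `A_q`; `lam ⟨i - 1, _⟩` is the `i`-th one
    (lam : Fin n → ℂ)
    (hspec : SNIFeedback.eigs G.Aq = Set.range lam)
    (hdistinct : Function.Injective lam)
    (hordered : Monotone (fun i => (lam i).re))
    (hstable : ∀ i : Fin n, (i : ℕ) + 1 < n → (lam i).re < 0)
    (hzero : lam ⟨n - 1, by omega⟩ = 0) :
    (∀ ε : ℝ, 0 < ε → ε < -(lam ⟨n - 2, by omega⟩).re →
      (∀ z ∈ SNIFeedback.eigs (G.Ar ε), z.re ≤ 0) ∧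
      G.ClosedLoopSNI (G.reducedGain ε) ε) ∧
    (∀ h3 : 3 ≤ n, ∀ ε₀ : ℝ,
      -(lam ⟨n - 2, by omega⟩).re < ε₀ → ε₀ < -(lam ⟨n - 3, by omega⟩).re →
      G.LyapunovSolvable ε₀ →
      (∀ ε : ℝ, 0 < ε → ε ≤ -(lam ⟨n - 2, by omega⟩).re →
        G.ClosedLoopSNI (G.reducedGain ε) ε) ∧
      (∀ ε : ℝ, -(lam ⟨n - 2, by omega⟩).re < ε → ε < -(lam ⟨n - 3, by omega⟩).re →
        G.LyapunovSolvable ε ∧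
        ∀ (p q : ℕ) (d : SNIFeedback.SchurSplit (G.Ar ε) p q)
          (T S : Matrix (Fin q) (Fin q) ℝ), G.IsLyapunovPair d T S →
          G.ClosedLoopSNI (G.lyapunovGain d T S) ε)) := by
  have hR : 0 < G.R 0 0 := posDef_fin_one_iff.1 hA2
  have hz : ∀ i : Fin n, ¬ (i : ℕ) + 1 < n → lam i = 0 := by
    intro i hi
    rw [← hzero]; congr 1; ext; simp; omega
  have hne : ∀ i : Fin n, (i : ℕ) + 1 < n → lam i ≠ 0 := by
    intro i hi h0
    have := hstable i hi
    simp [h0] at this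
  -- Indices start at `0`, so `i₂` labels `λ_{n-1}` and `γ = -(lam i₂).re`.
  set i₂ : Fin n := ⟨n - 2, by omega⟩ with hi₂
  have hi₂n : (i₂ : ℕ) + 1 < n := by simp [hi₂]; omega
  have hle : ∀ i : Fin n, (i : ℕ) + 1 < n → (lam i).re ≤ (lam i₂).re := fun i hi =>
    hordered (Fin.le_def.2 (by simp [hi₂]; omega))
  have hγ := hstable i₂ hi₂n
  have hAr := fun ε => Plant.eigs_Ar (by omega) hA1 hspec hdistinct hz hne ε
  have hred : ∀ ε : ℝ, 0 < ε → ε ≤ -(lam i₂).re → G.ClosedLoopSNI (G.reducedGain ε) ε := by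
    intro ε hε hle'
    refine G.closedLoopSNI_reducedGain hA1 hR hε fun z x hx0 hx hc => ?_
    obtain ⟨i, hi, rfl⟩ := Plant.exists_eq_lam hA1 hspec hdistinct hz hx0 hx hc
    linarith [hle i hi]
  refine ⟨fun ε hε hlt => ⟨?_, hred ε hε hlt.le⟩, fun h3 ε₀ h1 h2 hsol => ⟨hred, ?_⟩⟩
  · rw [hAr ε]
    rintro _ ⟨i, rfl⟩
    by_cases hi : (i : ℕ) + 1 < n
    · rw [Plant.lamR_of_lt hi]
      have := hle i hi
      simp; linarith
    · rw [Plant.lamR_of_not_lt hi]; simp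
  have hle3 : ∀ i : Fin n, (i : ℕ) + 1 < n → i ≠ i₂ →
      (lam i).re ≤ (lam ⟨n - 3, by omega⟩).re := fun i hi hne₂ =>
    hordered (Fin.le_def.2 (by
      have : (i : ℕ) ≠ n - 2 := fun h => hne₂ (Fin.ext h)
      simp; omega))
  -- the spectrum of `A_r` in the range of parameters with one unstable eigenvalue
  have hinjR : ∀ ε : ℝ, -(lam i₂).re < ε → ε < -(lam ⟨n - 3, by omega⟩).re →
      Function.Injective (Plant.lamR lam ε) := by
    intro ε hl hr
    refine Plant.lamR_injective hdistinct fun i hi h0 => ?_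
    have h0' := congrArg Complex.re h0
    simp at h0'
    by_cases hi' : i = i₂
    · rw [hi'] at h0'; linarith
    · linarith [hle3 i hi hi']
  have hposR : ∀ ε : ℝ, -(lam i₂).re < ε → 0 < (Plant.lamR lam ε i₂).re := by
    intro ε hl
    rw [Plant.lamR_of_lt hi₂n]; simp; linarith
  have hnegR : ∀ ε : ℝ, ε < -(lam ⟨n - 3, by omega⟩).re → ∀ i, i ≠ i₂ →
      (Plant.lamR lam ε i).re ≤ 0 := by
    intro ε hr i hi'
    by_cases hi : (i : ℕ) + 1 < n
    · rw [Plant.lamR_of_lt hi]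
      have := hle3 i hi hi'
      simp; linarith
    · rw [Plant.lamR_of_not_lt hi]; simp
  have hA22 : ∀ {ε : ℝ}, -(lam i₂).re < ε → ε < -(lam ⟨n - 3, by omega⟩).re →
      ∀ {p : ℕ} (d : SchurSplit (G.Ar ε) p 1), ((d.A₂₂ 0 0 : ℝ) : ℂ) = lam i₂ + ε := by
    intro ε hl hr p d
    rw [d.A₂₂_apply_eq (hAr ε) (hinjR ε hl hr) (hposR ε hl) (hnegR ε hr), Plant.lamR_of_lt hi₂n]
  -- the unstable eigenvalue is real
  obtain ⟨p₀, q₀, d₀, T₀, S₀, hTS₀⟩ := hsol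
  obtain rfl : q₀ = 1 := d₀.size_eq_one (hAr ε₀) (hinjR ε₀ h1 h2) (hposR ε₀ h1) (hnegR ε₀ h2)
  -- `λ_{n-1} + ε₀` is the entry of a real one-by-one block, so `λ_{n-1} = -γ`.
  have hreal : ((lam i₂).re : ℂ) = lam i₂ := by
    have := hA22 h1 h2 d₀
    have him := congrArg Complex.im this
    simp at him
    apply Complex.ext <;> simp [← him]
  have hA22' : ∀ {ε : ℝ}, -(lam i₂).re < ε → ε < -(lam ⟨n - 3, by omega⟩).re →
      ∀ {p : ℕ} (d : SchurSplit (G.Ar ε) p 1), d.A₂₂ 0 0 = ε - -(lam i₂).re := by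
    intro ε hl hr p d
    have := congrArg Complex.re (hA22 hl hr d)
    simp at this
    linarith
  intro ε hl hr
  have hpair : ∀ {u : Fin n → ℝ}, u ≠ 0 → u ᵥ* G.Ar ε = (ε - -(lam i₂).re) • u →
      ∀ x : Fin n → ℂ, x ≠ 0 → cplx (G.Ar ε) *ᵥ x = ((ε - -(lam i₂).re : ℝ) : ℂ) • x →
      (fun i => (u i : ℂ)) ⬝ᵥ x ≠ 0 := fun hu0 hu x hx0 hx =>
    left_eigenvector_unique_span (hAr ε) (hinjR ε hl hr) hu0 hu hx0 hx
  constructor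
  · have hu₀ := d₀.col_vecMul
    rw [hA22' h1 h2 d₀] at hu₀
    have hgap := hTS₀.gap hR
    have hpos₀ := ((G.isLyapunovPair_iff d₀ T₀ S₀).1 hTS₀).2.2.2.2
    rw [hA22' h1 h2 d₀] at hgap
    have ha₀ : 0 < ε₀ - -(lam i₂).re := by linarith
    obtain ⟨w, hw1, hw, hwpos⟩ := Plant.exists_unit_left_eigenvector (ε := ε) hA1 hu₀ h1 hl
      (hgap ▸ by positivity)
    have hw0 : w ≠ 0 := by rintro rfl; simp at hw1
    obtain ⟨d, rfl⟩ := SchurSplit.exists_of_left_eigenvector (by omega) hw1 hw (by linarith)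
      (hpair hw0 hw) (by
        intro z hzmem hzre
        rw [hAr ε] at hzmem
        obtain ⟨i, rfl⟩ := hzmem
        by_cases hi : i = i₂
        · rw [hi, Plant.lamR_of_lt hi₂n, ← hreal]; push_cast; simp; ring
        · exact absurd (hnegR ε hr i hi) (not_le.2 hzre))
    exact Plant.lyapunovSolvable_of_schurSplit d hR (by rw [hA22' hl hr d]; linarith) hwpos
  · intro p q d T S hTS
    obtain rfl : q = 1 := d.size_eq_one (hAr ε) (hinjR ε hl hr) (hposR ε hl) (hnegR ε hr)
    refine Plant.closedLoopSNI_lyapunovGain hA1 hR (by linarith) hTS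
      (by rw [hA22' hl hr d]; linarith) fun z x hx0 hx hc hux => ?_
    obtain ⟨i, hi, rfl⟩ := Plant.exists_eq_lam hA1 hspec hdistinct hz hx0 hx hc
    -- An eigenvector for `λ_{n-1}` in `ker c` is a right eigenvector of `A_r` for `ε - γ`, so it
    -- cannot be orthogonal to `u`. Every other mode already has real part at most `Re λ_{n-2} <
    -- -ε`.
    by_cases hi' : i = i₂
    · refine absurd hux (hpair d.col_ne_zero (hA22' hl hr d ▸ d.col_vecMul) x hx0 ?_)
      rw [G.Ar_mulVec hc, hx, hi', ← hreal, ← add_smul]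
      congr 1
      push_cast; simp; ring
    · linarith [hle3 i hi hi']
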